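/- Let $G$ be a graph and $X\subseteq V(G)$. Two vertices $u,v\in V(G)$ are $X$-visible if there is a shortest $u,v$-path $P$ in $G$ with $V(P)\cap X\subseteq\{u,v\}$. The set $X$ is a total mutual-visibility set of $G$ if any two vertices of $G$ are $X$-visible, and the total mutual-visibility number $\mu_{\rm t}(G)$ is the largest cardinality of a total mutual-visibility set of $G$. Let $F$ be a fullerene graph, that is, a finite connected simple cubic plane graph in which all faces are pentagons or hexagons. Let $\widehat F$ be the graph obtained from $F$ by inserting into each face of $F$ one new vertex, its central vertex, and joining it to all the vertices of that face. Then $F$ has exactly $12$ pentagonal faces, the central vertices of the pentagonal faces form a total mutual-visibility set of $\widehat F$, and $$\mu_{\rm t}(\widehat F)=12 .$$ -/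

import Mathlib

/-! ### Mutual-visibility -/

namespace SimpleGraph

/-- `u` and `v` are `X`-visible in `G`: some shortest `u,v`-path meets `X` at most in its
end-vertices. -/
def IsVisible {V : Type*} (G : SimpleGraph V) (X : Set V) (u v : V) : Prop :=
  ∃ p : G.Walk u v, p.IsPath ∧ p.length = G.dist u v ∧ ∀ w ∈ p.support, w ∈ X → w = u ∨ w = v

/-- `X` is a total mutual-visibility set of `G`: any two vertices of `G` are `X`-visible. -/
def IsTotalMutualVisibilitySet {V : Type*} (G : SimpleGraph V) (X : Set V) : Prop :=
  ∀ u v : V, G.IsVisible X u v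

/-- The total mutual-visibility number of `G`, the largest cardinality of a total
mutual-visibility set. On a finite connected graph the supremum is a maximum, since the empty set
is then a total mutual-visibility set and cardinalities are at most the order of `G`. -/
noncomputable def totalMutualVisibilityNumber {V : Type*} (G : SimpleGraph V) : ℕ :=
  sSup {n : ℕ | ∃ X : Finset V, G.IsTotalMutualVisibilitySet (X : Set V) ∧ X.card = n}

/-! ### Plane graphs -/

/-- A rotation system of `G`: for each vertex `v`, a cyclic ordering of the darts (oriented edges)
leaving `v`. All these orderings together are one permutation `next` of the darts, whose
orbits are the sets of darts with a common tail. This is a cellular embedding of `G` in a closed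
oriented surface (for connected `G` with an edge), `next` being the order of the edges around
their tail. -/
structure RotationSystem {V : Type*} (G : SimpleGraph V) where
  /-- The next dart around the tail of a given dart. -/
  next : Equiv.Perm G.Dart
  sameCycle_next_iff : ∀ d e : G.Dart, next.SameCycle d e ↔ d.fst = e.fst

namespace RotationSystem

variable {V : Type*} {G : SimpleGraph V}

/-- The permutation of the darts that traces the faces: from the dart `u → v`, go on along the dart
that follows `v → u` in the rotation at `v`. -/
def faceNext (R : G.RotationSystem) : Equiv.Perm G.Dart :=
  (Function.Involutive.toPerm Dart.symm Dart.symm_involutive).trans R.next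

/-- The faces of the embedding, given by their facial walks: the orbits of `faceNext`. -/
def Face (R : G.RotationSystem) : Type _ :=
  Quotient (Equiv.Perm.SameCycle.setoid R.faceNext)

/-- The face whose facial walk uses the dart `d`. -/
def faceOf (R : G.RotationSystem) (d : G.Dart) : R.Face :=
  Quotient.mk (Equiv.Perm.SameCycle.setoid R.faceNext) d

/-- The vertex `v` lies on (the boundary of) the face `f`. -/
def OnFace (R : G.RotationSystem) (v : V) (f : R.Face) : Prop :=
  ∃ d : G.Dart, R.faceOf d = f ∧ d.fst = v

/-- The length of the facial walk of `f`. -/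
noncomputable def faceLength (R : G.RotationSystem) (f : R.Face) : ℕ :=
  {d : G.Dart | R.faceOf d = f}.ncard

/-- `R` describes a connected plane graph (with at least one edge): `G` is connected and the
surface in which `R` embeds it is the sphere, that is, has Euler characteristic
`|V| - |E| + |F| = 2`. -/
structure IsPlane (R : G.RotationSystem) : Prop where
  connected : G.Connected
  euler : (Nat.card V : ℤ) - Nat.card G.edgeSet + Nat.card R.Face = 2

/-- `G` with the plane embedding `R` is a fullerene graph: a cubic plane graph in which all faces
are pentagons or hexagons. (As `G` is simple and cubic, a facial walk of length five or
six repeats no vertex, so that it is a cycle.) -/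
structure IsFullerene (R : G.RotationSystem) : Prop where
  plane : R.IsPlane
  cubic : ∀ v : V, (G.neighborSet v).ncard = 3
  pentagon_or_hexagon : ∀ f : R.Face, R.faceLength f = 5 ∨ R.faceLength f = 6

/-- Adjacency in the graph obtained by inserting a central vertex into each face. -/
def CenteredAdj (R : G.RotationSystem) : V ⊕ R.Face → V ⊕ R.Face → Prop
  | .inl u, .inl v => G.Adj u v
  | .inl u, .inr f => R.OnFace u f
  | .inr f, .inl v => R.OnFace v f
  | .inr _, .inr _ => False

/-- The graph obtained from `G` by inserting one vertex, the central vertex, into each face of the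
embedding and connecting it to all the vertices of this face. The central vertex of the
face `f` is `Sum.inr f`. -/
def centered (R : G.RotationSystem) : SimpleGraph (V ⊕ R.Face) where
  Adj := R.CenteredAdj
  symm := ⟨by
    rintro (u | f) (v | g) h
    · exact SimpleGraph.Adj.symm h
    · exact h
    · exact h
    · exact h⟩
  loopless := ⟨by
    rintro (u | f) h
    · exact SimpleGraph.Adj.ne h rfl
    · exact h⟩

/-- The central vertices of the pentagonal faces. -/
def pentagonCenters (R : G.RotationSystem) : Set (V ⊕ R.Face) :=
  Sum.inr '' {f : R.Face | R.faceLength f = 5}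

end RotationSystem

end SimpleGraph

/-!
Write `faceNext`, `next` and `symm` for the face permutation, the rotation and the reversal of the
darts. In a cubic graph `next` has order three, which gives the relation
`faceNext_symm_faceNext`; most of the local geometry is computed with it.

The central fact, `eq_of_faceOf_symm_eq`, is that two faces share at most one edge, that is, that
the dual graph is simple. No separation theorem is needed for it. Two shared edges cut the two facial
walks, of length at most six, into four paths, and the paths on each side of the shared edges form a
closed walk. These two closed walks have at most eight edges together, and a closed walk of this
kind with fewer than four edges is impossible for local reasons. So both have four edges, both faces
are hexagons, and the faces adjacent to a closed walk with four edges form again a pair that shares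
two edges. This property therefore spreads to all faces, all of them are hexagons, and this
contradicts the count of twelve pentagons (`ncard_pentagons`), the only place where the Euler
characteristic is used.

For the upper bound, the middle vertex of a path of length two that is the only shortest path
between its end-vertices lies in no total mutual-visibility set. Since two faces share at most one
edge, this applies to an original vertex, between a neighbour and the centre of the opposite
face (`inl_not_mem`), and to the centre of a hexagon, between two opposite vertices (`inr_not_mem`).
Only the twelve centres of pentagons remain. Conversely, a shortest path can bypass the centre of a
pentagon through a vertex of the pentagon, since a 5-cycle has diameter two.
-/

/-! ### Orbits of the rotation and of the face permutation -/

theorem Equiv.Perm.isCycleOn_setOf_sameCycle {α : Type*} (f : Equiv.Perm α) (x : α) :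
    f.IsCycleOn {y | f.SameCycle x y} := by
  refine ⟨⟨fun y hy => ?_, f.injective.injOn, fun y hy => ⟨f⁻¹ y, ?_, by simp⟩⟩, fun y hy z hz => ?_⟩
  · exact Equiv.Perm.sameCycle_apply_right.2 hy
  · exact Equiv.Perm.sameCycle_apply_right.1 (by simpa using hy)
  · exact (Equiv.Perm.SameCycle.symm hy).trans hz

theorem Equiv.Perm.IsCycleOn.iterate_eq_self_iff {α : Type*} {f : Equiv.Perm α} {s : Set α}
    (hf : f.IsCycleOn s) (hs : s.Finite) {x : α} (hx : x ∈ s) (n : ℕ) :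
    f^[n] x = x ↔ s.ncard ∣ n := by
  rw [← hs.coe_toFinset] at hf
  rw [Equiv.Perm.iterate_eq_pow, hf.pow_apply_eq (by simpa using hx),
    Set.ncard_eq_toFinset_card _ hs]

namespace SimpleGraph

theorem Dart.eq_of_fst_snd {V : Type*} {G : SimpleGraph V} {d e : G.Dart} (h₁ : d.fst = e.fst)
    (h₂ : d.snd = e.snd) : d = e :=
  Dart.ext _ _ (Prod.ext h₁ h₂)

namespace RotationSystem

variable {V : Type*} {G : SimpleGraph V} {R : G.RotationSystem}

theorem faceNext_apply (R : G.RotationSystem) (d : G.Dart) : R.faceNext d = R.next d.symm := rfl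

theorem fst_next (R : G.RotationSystem) (d : G.Dart) : (R.next d).fst = d.fst :=
  ((R.sameCycle_next_iff d (R.next d)).1 (Equiv.Perm.sameCycle_apply_right.2 (.refl _ _))).symm

theorem fst_faceNext (R : G.RotationSystem) (d : G.Dart) : (R.faceNext d).fst = d.snd :=
  R.fst_next _

theorem faceOf_eq_iff {d e : G.Dart} : R.faceOf d = R.faceOf e ↔ R.faceNext.SameCycle d e :=
  Quotient.eq

theorem exists_faceOf_eq (f : R.Face) : ∃ d, R.faceOf d = f := Quotient.exists_rep f

@[simp]
theorem faceOf_faceNext (d : G.Dart) : R.faceOf (R.faceNext d) = R.faceOf d :=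
  (faceOf_eq_iff.2 (Equiv.Perm.sameCycle_apply_right.2 (.refl _ _))).symm

@[simp]
theorem faceOf_faceNext_symm (d : G.Dart) : R.faceOf (R.faceNext.symm d) = R.faceOf d := by
  rw [← faceOf_faceNext (R.faceNext.symm d), Equiv.apply_symm_apply]

@[simp]
theorem faceOf_iterate (n : ℕ) (d : G.Dart) : R.faceOf (R.faceNext^[n] d) = R.faceOf d := by
  induction n with
  | zero => rfl
  | succ n ih => rw [Function.iterate_succ_apply', faceOf_faceNext, ih]

instance [Finite V] : Finite G.Dart := Finite.of_injective _ Dart.toProd_injective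

instance [Finite V] : Finite R.Face := Quotient.finite _

theorem isCycleOn_faceNext (d : G.Dart) :
    R.faceNext.IsCycleOn {e | R.faceOf e = R.faceOf d} := by
  have hs : {e | R.faceOf e = R.faceOf d} = {e | R.faceNext.SameCycle d e} := by
    ext e; exact eq_comm.trans faceOf_eq_iff
  exact hs ▸ R.faceNext.isCycleOn_setOf_sameCycle d

theorem iterate_faceNext_eq_self_iff [Finite V] (d : G.Dart) (n : ℕ) :
    R.faceNext^[n] d = d ↔ R.faceLength (R.faceOf d) ∣ n :=
  (isCycleOn_faceNext d).iterate_eq_self_iff (Set.toFinite _) rfl n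

theorem exists_iterate_faceNext_eq [Finite V] {d e : G.Dart} (h : R.faceOf d = R.faceOf e) :
    ∃ n < R.faceLength (R.faceOf d), R.faceNext^[n] d = e := by
  have hf : {e | R.faceOf e = R.faceOf d}.Finite := Set.toFinite _
  have hc := isCycleOn_faceNext (R := R) d
  rw [← hf.coe_toFinset] at hc
  obtain ⟨n, hn, h⟩ := hc.exists_pow_eq (a := d) (b := e) (by simp) (by simp [h])
  rw [← Set.ncard_eq_toFinset_card _ hf] at hn
  exact ⟨n, hn, by rwa [Equiv.Perm.iterate_eq_pow]⟩

theorem ncard_darts_fst (G : SimpleGraph V) (v : V) :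
    {d : G.Dart | d.fst = v}.ncard = (G.neighborSet v).ncard := by
  refine Set.ncard_congr (fun d _ => d.snd) (fun d hd => ?_) (fun d e hd he h => ?_)
    (fun w hw => ⟨⟨(v, w), hw⟩, rfl, rfl⟩)
  · exact (show d.fst = v from hd) ▸ d.adj
  · exact Dart.eq_of_fst_snd (hd.trans he.symm) h

/-! ### Facial walks of fullerenes -/

namespace IsFullerene

theorem iterate_next_eq_self_iff [Finite V] (hF : R.IsFullerene) (d : G.Dart) (n : ℕ) :
    R.next^[n] d = d ↔ 3 ∣ n := by
  have hs : {e : G.Dart | e.fst = d.fst} = {e | R.next.SameCycle d e} := by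
    ext e; exact eq_comm.trans (R.sameCycle_next_iff d e).symm
  have hc := R.next.isCycleOn_setOf_sameCycle d
  rw [← hs] at hc
  rw [hc.iterate_eq_self_iff (Set.toFinite _) rfl, ncard_darts_fst, hF.cubic]

theorem next_next_next [Finite V] (hF : R.IsFullerene) (d : G.Dart) :
    R.next (R.next (R.next d)) = d :=
  (hF.iterate_next_eq_self_iff d 3).2 dvd_rfl

theorem next_ne [Finite V] (hF : R.IsFullerene) (d : G.Dart) : R.next d ≠ d := fun h => by
  simpa using (hF.iterate_next_eq_self_iff d 1).1 h

/-- The relation `(faceNext ∘ symm)³ = 1` between the face permutation and the reversal, which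
expresses that the graph is cubic, solved for a turn in the direction opposite to `faceNext`. -/
theorem faceNext_symm_faceNext [Finite V] (hF : R.IsFullerene) (d : G.Dart) :
    R.faceNext (R.faceNext d).symm = (R.faceNext.symm d.symm).symm := by
  have h : R.faceNext (R.faceNext (R.faceNext d).symm).symm = d.symm :=
    hF.next_next_next d.symm
  rw [← h, Equiv.symm_apply_apply, Dart.symm_symm]

/-- The darts leaving the tail of `d` are `d`, `next d` and `next (next d)`, written here in terms of
`faceNext`. -/
theorem eq_or_eq_or_eq_of_fst_eq [Finite V] (hF : R.IsFullerene) {d e : G.Dart}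
    (h : e.fst = d.fst) :
    e = d ∨ e = R.faceNext d.symm ∨ e = (R.faceNext.symm d).symm := by
  have h2 : (R.faceNext.symm d).symm = R.next (R.next d) := by
    have := hF.faceNext_symm_faceNext d.symm
    rw [Dart.symm_symm] at this
    exact this.symm
  rw [h2, faceNext_apply, Dart.symm_symm]
  obtain ⟨n, h⟩ := ((R.sameCycle_next_iff d e).2 h.symm).exists_nat_pow_eq
  subst h
  clear h2
  induction n with
  | zero => exact .inl rfl
  | succ n ih =>
    rw [pow_succ', Equiv.Perm.mul_apply]
    rcases ih (R.sameCycle_next_iff d _ |>.1 ⟨n, by simp⟩).symm with h | h | h <;> rw [h]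
    · simp
    · simp
    · simp [hF.next_next_next]

theorem iterate_faceNext_ne [Finite V] (hF : R.IsFullerene) (d : G.Dart) {n : ℕ} (h0 : 0 < n)
    (h5 : n < 5) : R.faceNext^[n] d ≠ d := fun h => by
  have h' := Nat.le_of_dvd h0 ((iterate_faceNext_eq_self_iff d n).1 h)
  rcases hF.pentagon_or_hexagon (R.faceOf d) with h | h <;> omega

theorem exists_iterate_lt_six [Finite V] (hF : R.IsFullerene) {d e : G.Dart}
    (h : R.faceOf d = R.faceOf e) : ∃ n < 6, R.faceNext^[n] d = e := by
  obtain ⟨n, hn, h⟩ := exists_iterate_faceNext_eq h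
  refine ⟨n, ?_, h⟩
  rcases hF.pentagon_or_hexagon (R.faceOf d) with h | h <;> omega

theorem iterate_five_or_six [Finite V] (hF : R.IsFullerene) (d : G.Dart) :
    R.faceNext^[5] d = d ∨ R.faceNext^[6] d = d :=
  (hF.pentagon_or_hexagon (R.faceOf d)).imp
    (fun h => (iterate_faceNext_eq_self_iff d 5).2 (by rw [h]))
    (fun h => (iterate_faceNext_eq_self_iff d 6).2 (by rw [h]))

/-- A facial walk of length at most six in a simple cubic graph uses no edge in both directions. -/
theorem faceOf_symm_ne [Finite V] (hF : R.IsFullerene) (d : G.Dart) :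
    R.faceOf d.symm ≠ R.faceOf d := by
  intro h
  have h56 := hF.iterate_five_or_six d
  obtain ⟨n, hn6, hn⟩ := hF.exists_iterate_lt_six h.symm
  have hflip : R.faceNext d.symm = R.next d := rfl
  -- Two steps of the facial walk cannot reverse a dart, as they would end at a loop.
  have htwo : ∀ c : G.Dart, R.faceNext (R.faceNext c) ≠ c.symm := fun c hc => by
    have h1 : (R.faceNext (R.faceNext c)).fst = c.snd := by rw [hc]; rfl
    rw [fst_faceNext, ← fst_faceNext R c] at h1
    exact (R.faceNext c).snd_ne_fst h1
  interval_cases n <;> simp only [Function.iterate_succ_apply, Function.iterate_zero, id] at hn h56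
  · exact d.symm_ne hn.symm
  · exact hF.next_ne _ hn
  · exact htwo d hn
  · -- The third dart ends at the tail of the second one, so the walk would turn back there.
    have h1 : R.faceNext (R.faceNext d) = (R.faceNext d).symm := by
      refine Dart.eq_of_fst_snd (fst_faceNext _ _) ?_
      rw [← fst_faceNext, hn]
      exact (fst_faceNext R d).symm
    exact hF.next_ne _ h1
  · -- The next dart is `next d`, so that the walk has length six and leads from `d.symm` to `d` in
    -- two steps.
    rw [hn, hflip] at h56
    rcases h56 with h56 | h56
    · exact hF.next_ne _ h56
    · have h1 := htwo d.symm
      rw [hflip] at h1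
      exact h1 h56
  · rw [hn, hflip] at h56
    rcases h56 with h56 | h56
    · exact d.symm_ne h56
    · exact hF.next_ne _ h56

/-- A facial walk repeats no vertex. -/
theorem eq_of_fst_eq_of_faceOf_eq [Finite V] (hF : R.IsFullerene) {d e : G.Dart}
    (h : d.fst = e.fst) (hf : R.faceOf d = R.faceOf e) : d = e := by
  rcases hF.eq_or_eq_or_eq_of_fst_eq h with h | h | h
  · exact h
  · rw [h, faceOf_faceNext] at hf
    exact (hF.faceOf_symm_ne e hf).elim
  · rw [h, ← faceOf_faceNext_symm e] at hf
    exact (hF.faceOf_symm_ne _ hf).elim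

/-- The faces across two consecutive edges of a face are different. -/
theorem faceOf_symm_faceNext_ne [Finite V] (hF : R.IsFullerene) (d : G.Dart) :
    R.faceOf (R.faceNext d).symm ≠ R.faceOf d.symm := by
  intro h
  have h1 := congrArg R.faceOf (hF.faceNext_symm_faceNext d)
  rw [faceOf_faceNext, h, ← faceOf_faceNext_symm d.symm] at h1
  exact hF.faceOf_symm_ne _ h1.symm

end IsFullerene
end RotationSystem
end SimpleGraph

/-! ### Counting pentagons -/
namespace SimpleGraph
namespace RotationSystem

variable {V : Type*} {G : SimpleGraph V} {R : G.RotationSystem}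

theorem sum_faceLength [Finite V] [Fintype R.Face] :
    ∑ f : R.Face, R.faceLength f = Nat.card G.Dart := by
  classical
  have := Fintype.ofFinite G.Dart
  rw [Nat.card_eq_fintype_card, ← Finset.card_univ,
    Finset.card_eq_sum_card_fiberwise (f := R.faceOf) (t := Finset.univ) (by simp)]
  refine Finset.sum_congr rfl fun f _ => ?_
  rw [faceLength, Set.ncard_eq_toFinset_card']
  congr 1
  ext; simp

/-- A property of darts that is inherited by the next dart of the face and by the reverse dart holds
for all darts of a connected graph as soon as it holds for one. -/
theorem forall_dart_of_connected [Finite V] (hG : G.Connected) {P : G.Dart → Prop}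
    (hnext : ∀ c, P c → P (R.faceNext c)) (hsymm : ∀ c, P c → P c.symm) {d : G.Dart} (hd : P d)
    (e : G.Dart) : P e := by
  have hrot : ∀ c c' : G.Dart, c.fst = c'.fst → P c → P c' := by
    intro c c' h hc
    obtain ⟨n, h⟩ := ((R.sameCycle_next_iff c c').2 h).exists_nat_pow_eq
    subst h
    clear h
    induction n with
    | zero => exact hc
    | succ n ih =>
      rw [pow_succ', Equiv.Perm.mul_apply]
      have h1 := hnext _ (hsymm _ ih)
      rwa [faceNext_apply, Dart.symm_symm] at h1
  obtain ⟨p⟩ := hG.preconnected d.fst e.fst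
  have key : ∀ {u v : V} (p : G.Walk u v) (c c' : G.Dart), c.fst = u → c'.fst = v → P c → P c' := by
    intro u v p
    induction p with
    | nil => exact fun c c' h h' => hrot c c' (h.trans h'.symm)
    | cons h p ih =>
      intro c c' hc hc' hP
      exact ih (Dart.mk (_, _) h).symm c' rfl hc' (hsymm _ (hrot c _ hc hP))
  exact key p d e rfl rfl hd

namespace IsFullerene

/-- Euler's formula and double counting of the darts, by vertices, edges and faces. -/
theorem ncard_pentagons [Finite V] (hF : R.IsFullerene) :
    {f : R.Face | R.faceLength f = 5}.ncard = 12 := by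
  classical
  have := Fintype.ofFinite V
  have := Fintype.ofFinite R.Face
  have hV : Fintype.card G.Dart = 3 * Fintype.card V := by
    rw [dart_card_eq_sum_degrees, Finset.sum_congr rfl (fun v _ => ?_), Finset.sum_const,
      Finset.card_univ, smul_eq_mul, mul_comm]
    rw [← card_neighborSet_eq_degree, ← hF.cubic v, ← Nat.card_coe_set_eq, Nat.card_eq_fintype_card]
  have hE : Fintype.card G.Dart = 2 * Nat.card G.edgeSet := by
    rw [dart_card_eq_twice_card_edges, Nat.card_eq_fintype_card, edgeFinset_card]
  have hL : Fintype.card G.Dart + {f : R.Face | R.faceLength f = 5}.ncard = 6 * Nat.card R.Face := by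
    rw [← Nat.card_eq_fintype_card, ← sum_faceLength (R := R), Set.ncard_eq_toFinset_card',
      Set.toFinset_ofPred, Finset.card_filter, ← Finset.sum_add_distrib,
      Finset.sum_congr rfl (fun f _ => ?_), Finset.sum_const, Finset.card_univ, smul_eq_mul,
      mul_comm, Nat.card_eq_fintype_card]
    rcases hF.pentagon_or_hexagon f with h | h <;> simp [h]
  have heul := hF.plane.euler
  rw [Nat.card_eq_fintype_card (α := V)] at heul
  omega

end IsFullerene
end RotationSystem
end SimpleGraph

/-! ### Two faces share at most one edge -/
namespace SimpleGraph
namespace RotationSystem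

variable {V : Type*} {G : SimpleGraph V} {R : G.RotationSystem}

/-- The face `f` has two different edges across which lies the same face. -/
def IsDoubled (R : G.RotationSystem) (f : R.Face) : Prop :=
  ∃ d e : G.Dart, d ≠ e ∧ R.faceOf d = f ∧ R.faceOf e = f ∧ R.faceOf d.symm = R.faceOf e.symm

/-- Going `i` steps along the face of `d`, reversing, and then going `j` steps along the face reached
in this way leads to the reverse of `d`. For positive `i` and `j` below the lengths of these faces
this says that the faces on both sides of `d` share a second edge, and that the facial paths between
the two shared edges, on one side of them, have `i - 1` and `j - 1` edges. -/
def ReturnsAfter (R : G.RotationSystem) (i j : ℕ) (d : G.Dart) : Prop :=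
  R.faceNext^[j] (R.faceNext^[i] d).symm = d.symm

theorem ReturnsAfter.flip {i j : ℕ} {d : G.Dart} (h : R.ReturnsAfter i j d) :
    R.ReturnsAfter j i (R.faceNext^[i] d).symm := by
  rw [ReturnsAfter] at *
  rw [h, Dart.symm_symm, Dart.symm_symm]

theorem ReturnsAfter.faceOf_symm_eq {i j : ℕ} {d : G.Dart} (h : R.ReturnsAfter i j d) :
    R.faceOf (R.faceNext^[i] d).symm = R.faceOf d.symm := by
  rw [← h, faceOf_iterate]

namespace IsFullerene

theorem not_returnsAfter_one_left [Finite V] (hF : R.IsFullerene) (j : ℕ) (d : G.Dart) :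
    ¬ R.ReturnsAfter 1 j d := fun h =>
  hF.faceOf_symm_faceNext_ne d h.faceOf_symm_eq

theorem not_returnsAfter_one_right [Finite V] (hF : R.IsFullerene) (i : ℕ) (d : G.Dart) :
    ¬ R.ReturnsAfter i 1 d := fun h => hF.not_returnsAfter_one_left i _ h.flip

/-- The two paths between the shared edges would consist of one edge each and be parallel. -/
theorem not_returnsAfter_two_two [Finite V] (hF : R.IsFullerene) (d : G.Dart) :
    ¬ R.ReturnsAfter 2 2 d := by
  intro h
  simp only [ReturnsAfter, Function.iterate_succ_apply, Function.iterate_zero, id] at h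
  have h1 : R.faceNext (R.faceNext (R.faceNext d)).symm = (R.faceNext d).symm := by
    refine Dart.eq_of_fst_snd ?_ ?_
    · rw [fst_faceNext]
      exact fst_faceNext _ _
    · rw [← fst_faceNext, h]
      exact (fst_faceNext _ _).symm
  refine hF.faceOf_symm_faceNext_ne (R.faceNext d) ?_
  rw [← h1, faceOf_faceNext]

/-- The two paths between the shared edges would form a triangle; the third edge at the vertex
of the triangle on no shared edge would have the same face on both sides. -/
theorem not_returnsAfter_two_three [Finite V] (hF : R.IsFullerene) (d : G.Dart) :
    ¬ R.ReturnsAfter 2 3 d := by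
  intro h
  simp only [ReturnsAfter, Function.iterate_succ_apply, Function.iterate_zero, id] at h
  -- `w` lies two steps before the reverse of the single edge `faceNext d` between the shared edges.
  obtain ⟨w', hw'⟩ := R.faceNext.surjective (R.faceNext d).symm
  obtain ⟨w, rfl⟩ := R.faceNext.surjective w'
  have r1 := hF.faceNext_symm_faceNext (R.faceNext d)
  rw [← hw', Equiv.symm_apply_apply] at r1
  have r2 := hF.faceNext_symm_faceNext w
  have r3 := hF.faceNext_symm_faceNext (R.faceNext (R.faceNext w))
  rw [hw', Dart.symm_symm, Equiv.symm_apply_apply, ← hw', ← h, r1, r2] at r3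
  have r4 := congrArg R.faceOf (Dart.symm_involutive.injective (R.faceNext.injective r3))
  simp only [faceOf_faceNext, faceOf_faceNext_symm] at r4
  exact hF.faceOf_symm_ne w r4.symm

/-- The paths between the shared edges form a quadrangle. Two of its vertices lie on no shared edge,
and the faces inside that are adjacent to the quadrangle share the remaining edges at both. -/
theorem isDoubled_of_returnsAfter_two_four [Finite V] (hF : R.IsFullerene) {d : G.Dart}
    (h : R.ReturnsAfter 2 4 d) :
    R.IsDoubled (R.faceOf (R.faceNext d).symm) ∧
      ∀ k, 1 ≤ k → k < 4 →
        R.IsDoubled (R.faceOf (R.faceNext^[k] (R.faceNext^[2] d).symm).symm) := by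
  simp only [ReturnsAfter, Function.iterate_succ_apply, Function.iterate_zero, id] at h
  -- `w` lies two steps before the reverse of the single edge `faceNext d` between the shared edges.
  obtain ⟨w', hw'⟩ := R.faceNext.surjective (R.faceNext d).symm
  obtain ⟨w, rfl⟩ := R.faceNext.surjective w'
  have r1 := hF.faceNext_symm_faceNext (R.faceNext d)
  rw [← hw', Equiv.symm_apply_apply] at r1
  have r2 := hF.faceNext_symm_faceNext w
  have r3 := hF.faceNext_symm_faceNext (R.faceNext (R.faceNext w))
  rw [hw', Dart.symm_symm, Equiv.symm_apply_apply, ← hw', ← h, r1, r2] at r3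
  have r4 := hF.faceNext_symm_faceNext (R.faceNext^[4] w).symm
  simp only [Function.iterate_succ_apply, Function.iterate_zero, id, Dart.symm_symm,
    Equiv.symm_apply_apply] at r4
  rw [R.faceNext.injective r3] at r4
  -- The faces of `w` and `w.symm` share a further edge.
  have r5 := congrArg R.faceOf (Dart.symm_involutive.injective (R.faceNext.injective r4))
  simp only [faceOf_faceNext, faceOf_faceNext_symm] at r5
  have hne : R.faceNext^[4] w ≠ w := hF.iterate_faceNext_ne w (by norm_num) (by norm_num)
  have hw : R.IsDoubled (R.faceOf w) := ⟨_, w, hne, faceOf_iterate 4 w, rfl, r5⟩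
  have hws : R.IsDoubled (R.faceOf w.symm) :=
    ⟨_, w.symm, Dart.symm_involutive.injective.ne hne, r5, rfl, by
      rw [Dart.symm_symm, Dart.symm_symm]; exact faceOf_iterate 4 w⟩
  have hw2 : R.faceOf (R.faceNext d).symm = R.faceOf w := by
    rw [← hw', faceOf_faceNext, faceOf_faceNext]
  refine ⟨hw2 ▸ hw, fun k h1 h4 => ?_⟩
  interval_cases k <;>
    simp only [Function.iterate_succ_apply, Function.iterate_zero, id, r1, r2, Dart.symm_symm,
      faceOf_faceNext, faceOf_faceNext_symm]
  · exact hw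
  · exact hws
  · rw [← R.faceNext.injective r3]
    simpa using hw

/-- As in `isDoubled_of_returnsAfter_two_four`, but the vertices of the quadrangle that lie on no
shared edge are opposite instead of adjacent. -/
theorem isDoubled_of_returnsAfter_three_three [Finite V] (hF : R.IsFullerene) {d : G.Dart}
    (h : R.ReturnsAfter 3 3 d) (k : ℕ) (h1 : 1 ≤ k) (h3 : k < 3) :
    R.IsDoubled (R.faceOf (R.faceNext^[k] d).symm) := by
  simp only [ReturnsAfter, Function.iterate_succ_apply, Function.iterate_zero, id] at h
  have r1 := hF.faceNext_symm_faceNext (R.faceNext d)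
  have r2 := hF.faceNext_symm_faceNext (R.faceNext (R.faceNext d))
  rw [r2] at h
  -- `q` is the first edge of the path on the face across `d`.
  obtain ⟨q, hq⟩ : ∃ q : G.Dart, q = (R.faceNext.symm (R.faceNext (R.faceNext d)).symm).symm :=
    ⟨_, rfl⟩
  rw [← hq] at h
  have r3 := hF.faceNext_symm_faceNext (R.faceNext q)
  have r4 := hF.faceNext_symm_faceNext q
  rw [h, Dart.symm_symm] at r3
  have r5 : R.faceNext (R.faceNext d).symm = (R.faceNext q).symm := by
    rw [r3, Dart.symm_symm, Equiv.apply_symm_apply]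
  have hne : R.faceNext (R.faceNext (R.faceNext d).symm) ≠ R.faceNext.symm (R.faceNext d).symm :=
    fun h' => hF.iterate_faceNext_ne (R.faceNext.symm (R.faceNext d).symm) (n := 3)
      (by norm_num) (by norm_num) (by simpa [Function.iterate_succ_apply] using h')
  have hl : R.faceOf (R.faceNext (R.faceNext (R.faceNext d).symm)).symm =
      R.faceOf (R.faceNext (R.faceNext d)).symm := by
    rw [r5, r4, hq]; simp
  have hr : R.faceOf (R.faceNext.symm (R.faceNext d).symm).symm =
      R.faceOf (R.faceNext (R.faceNext d)).symm := by
    rw [← r1, faceOf_faceNext]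
  interval_cases k
  · exact ⟨_, _, hne, by simp, by simp, hl.trans hr.symm⟩
  · exact ⟨_, _, Dart.symm_involutive.injective.ne hne, hl, hr, by simp⟩

/-- In the extremal case `i + j = 6`, each face across an edge of the facial path between the two
shared edges again shares two edges with some face. -/
theorem isDoubled_of_returnsAfter [Finite V] (hF : R.IsFullerene) {d : G.Dart} {i j : ℕ}
    (h : R.ReturnsAfter i j d) (hij : i + j = 6) (hj : 1 ≤ j)
    (k : ℕ) (h1 : 1 ≤ k)
    (hk : k < i) :
    R.IsDoubled (R.faceOf (R.faceNext^[k] d).symm) := by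
  have hj4 : j ≤ 4 := by omega
  interval_cases j
  · exact (hF.not_returnsAfter_one_right i d h).elim
  · obtain rfl : i = 4 := by omega
    have h' := (hF.isDoubled_of_returnsAfter_two_four h.flip).2 k h1 hk
    have h2 : (R.faceNext^[2] (R.faceNext^[4] d).symm).symm = d := by
      rw [h, Dart.symm_symm]
    rwa [h2] at h'
  · obtain rfl : i = 3 := by omega
    exact hF.isDoubled_of_returnsAfter_three_three h k h1 hk
  · obtain rfl : i = 2 := by omega
    obtain rfl : k = 1 := by omega
    exact (hF.isDoubled_of_returnsAfter_two_four h).1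

/-- The paths between two edges shared by two faces have at least four edges together. -/
theorem six_le_of_returnsAfter [Finite V] (hF : R.IsFullerene) {d : G.Dart} {i j : ℕ} (hi : 1 ≤ i)
    (hj : 1 ≤ j) (h : R.ReturnsAfter i j d) : 6 ≤ i + j := by
  by_contra hlt
  have hi1 : i ≠ 1 := fun h1 => hF.not_returnsAfter_one_left j d (h1 ▸ h)
  have hj1 : j ≠ 1 := fun h1 => hF.not_returnsAfter_one_right i d (h1 ▸ h)
  obtain ⟨rfl, rfl⟩ | ⟨rfl, rfl⟩ | ⟨rfl, rfl⟩ :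
      (i = 2 ∧ j = 2) ∨ (i = 2 ∧ j = 3) ∨ (i = 3 ∧ j = 2) := by omega
  · exact hF.not_returnsAfter_two_two d h
  · exact hF.not_returnsAfter_two_three d h
  · exact hF.not_returnsAfter_two_three _ h.flip

/-- Two edges shared by two faces cut both facial walks into two paths each. The four paths have at
most `6 + 6 - 4 = 8` edges in total, and at least four on either side of the shared edges. Hence
equality holds throughout, and both faces are hexagons. -/
theorem exists_returnsAfter [Finite V] (hF : R.IsFullerene) {d e : G.Dart} (hne : d ≠ e)
    (hf : R.faceOf d = R.faceOf e) (hs : R.faceOf d.symm = R.faceOf e.symm) :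
    R.faceLength (R.faceOf d) = 6 ∧ ∃ i j : ℕ, 1 ≤ i ∧ i < 6 ∧ 1 ≤ j ∧ i + j = 6 ∧
      R.ReturnsAfter i j d ∧ R.ReturnsAfter j i e ∧
      R.faceNext^[i] d = e ∧ R.faceNext^[j] e = d := by
  obtain ⟨i, hi, hie⟩ := exists_iterate_faceNext_eq hf
  obtain ⟨j, hj, hjd⟩ := exists_iterate_faceNext_eq hs.symm
  have hi0 : i ≠ 0 := by rintro rfl; exact hne hie
  have hj0 : j ≠ 0 := by rintro rfl; exact hne (Dart.symm_involutive.injective hjd).symm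
  have hie' : R.faceNext^[R.faceLength (R.faceOf d) - i] e = d := by
    rw [← hie, ← Function.iterate_add_apply, Nat.sub_add_cancel hi.le]
    exact (iterate_faceNext_eq_self_iff _ _).2 dvd_rfl
  have hjd' : R.faceNext^[R.faceLength (R.faceOf d.symm) - j] d.symm = e.symm := by
    rw [hs]
    rw [← hjd, ← Function.iterate_add_apply, Nat.sub_add_cancel hj.le]
    exact (iterate_faceNext_eq_self_iff _ _).2 dvd_rfl
  rw [← hs] at hj
  have h1 : R.ReturnsAfter i j d := by rw [ReturnsAfter, hie, hjd]
  have h2 : R.ReturnsAfter (R.faceLength (R.faceOf d) - i)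
      (R.faceLength (R.faceOf d.symm) - j) e := by rw [ReturnsAfter, hie', hjd']
  have h3 := hF.six_le_of_returnsAfter (by omega) (by omega) h1
  have h4 := hF.six_le_of_returnsAfter (by omega) (by omega) h2
  have h5 := hF.pentagon_or_hexagon (R.faceOf d)
  have h6 := hF.pentagon_or_hexagon (R.faceOf d.symm)
  have e1 : R.faceLength (R.faceOf d) = 6 := by omega
  have e2 : R.faceLength (R.faceOf d.symm) - j = i := by omega
  have e3 : R.faceLength (R.faceOf d) - i = j := by omega
  rw [e2, e3] at h2
  rw [e3] at hie'
  exact ⟨e1, i, j, by omega, by omega, by omega, by omega, h1, h2, hie, hie'⟩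

/-- Having two edges with the same face across them passes to all neighbouring faces. -/
theorem isDoubled_faceOf_symm [Finite V] (hF : R.IsFullerene) {c : G.Dart}
    (h : R.IsDoubled (R.faceOf c)) : R.IsDoubled (R.faceOf c.symm) := by
  obtain ⟨d, e, hne, hd, he, hs⟩ := h
  have hds : R.IsDoubled (R.faceOf d.symm) :=
    ⟨d.symm, e.symm, Dart.symm_involutive.injective.ne hne, rfl, hs.symm, by simp [hd, he]⟩
  obtain ⟨-, i, j, hi, hi6, hj, hij, hr, hr', hie, hje⟩ :=
    hF.exists_returnsAfter hne (hd.trans he.symm) hs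
  obtain ⟨k, hk, rfl⟩ := hF.exists_iterate_lt_six hd
  rcases Nat.eq_zero_or_pos k with rfl | hk0
  · exact hds
  rcases lt_trichotomy k i with hki | rfl | hki
  · exact hF.isDoubled_of_returnsAfter hr hij hj k hk0 hki
  · rwa [hie, ← hs]
  · have h' := hF.isDoubled_of_returnsAfter hr' (by omega) hi (k - i) (by omega) (by omega)
    rwa [← hie, ← Function.iterate_add_apply, Nat.sub_add_cancel hki.le] at h'

/-- Two different edges of a face have different faces on their other sides. Otherwise all faces
would share two edges with some other face; since such faces are hexagons, this contradicts
the existence of pentagons. -/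
theorem eq_of_faceOf_symm_eq [Finite V] (hF : R.IsFullerene) {d e : G.Dart}
    (hf : R.faceOf d = R.faceOf e) (hs : R.faceOf d.symm = R.faceOf e.symm) : d = e := by
  by_contra hne
  have hall : ∀ c : G.Dart, R.IsDoubled (R.faceOf c) :=
    forall_dart_of_connected (R := R) hF.plane.connected
      (fun c hc => by rwa [faceOf_faceNext]) (fun c hc => hF.isDoubled_faceOf_symm hc)
      (d := d) ⟨d, e, hne, rfl, hf.symm, hs⟩
  have h12 := hF.ncard_pentagons
  obtain ⟨f, hf5⟩ : {f : R.Face | R.faceLength f = 5}.Nonempty :=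
    Set.nonempty_of_ncard_ne_zero (by omega)
  obtain ⟨c, rfl⟩ := exists_faceOf_eq f
  obtain ⟨d, e, hne, hd, he, hs⟩ := hall c
  have h6 := (hF.exists_returnsAfter hne (hd.trans he.symm) hs).1
  rw [hd, show R.faceLength (R.faceOf c) = 5 from hf5] at h6
  omega

end IsFullerene
end RotationSystem
end SimpleGraph

/-! ### Visibility and convex paths of length two -/
namespace SimpleGraph

/-- The middle vertex of the only path of length two between two non-adjacent vertices lies in no
total mutual-visibility set. -/
theorem IsTotalMutualVisibilitySet.not_mem {V : Type*} {G : SimpleGraph V} {X : Set V}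
    (hX : G.IsTotalMutualVisibilitySet X) {u v w : V} (huv : u ≠ v) (hadj : ¬ G.Adj u v)
    (hu : G.Adj u w) (hv : G.Adj w v) (h : ∀ x, G.Adj u x → G.Adj x v → x = w) : w ∉ X := by
  intro hw
  obtain ⟨p, -, hp, hpX⟩ := hX u v
  have hle : p.length ≤ 2 := hp ▸ dist_le (.cons hu (.cons hv .nil))
  match p, hle, hpX with
  | .nil, _, _ => exact huv rfl
  | .cons h1 .nil, _, _ => exact hadj h1
  | .cons h1 (.cons h2 .nil), _, hpX =>
    obtain rfl := h _ h1 h2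
    rcases hpX _ (by simp) hw with h' | h'
    · exact h1.ne' h'
    · exact h2.ne h'
  | .cons _ (.cons _ (.cons _ q)), hle, _ => simp at hle

namespace RotationSystem

variable {V : Type*} {G : SimpleGraph V} {R : G.RotationSystem}

theorem onFace_fst (d : G.Dart) : R.OnFace d.fst (R.faceOf d) := ⟨d, rfl, rfl⟩

theorem onFace_snd (d : G.Dart) : R.OnFace d.snd (R.faceOf d) :=
  ⟨R.faceNext d, faceOf_faceNext d, fst_faceNext R d⟩

theorem onFace_fst_symm (d : G.Dart) : R.OnFace d.fst (R.faceOf d.symm) := onFace_snd d.symm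

theorem onFace_snd_symm (d : G.Dart) : R.OnFace d.snd (R.faceOf d.symm) := onFace_fst d.symm

namespace IsFullerene

/-- The three faces at the tail of a dart. -/
theorem onFace_fst_iff [Finite V] (hF : R.IsFullerene) (d : G.Dart) (f : R.Face) :
    R.OnFace d.fst f ↔ f = R.faceOf d ∨ f = R.faceOf d.symm ∨
      f = R.faceOf (R.faceNext.symm d).symm := by
  constructor
  · rintro ⟨e, rfl, he⟩
    rcases hF.eq_or_eq_or_eq_of_fst_eq he with h | h | h <;> rw [h]
    · exact .inl rfl
    · exact .inr (.inl (faceOf_faceNext _))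
    · exact .inr (.inr rfl)
  · rintro (rfl | rfl | rfl)
    · exact onFace_fst d
    · exact onFace_snd d.symm
    · refine ⟨_, rfl, ?_⟩
      exact (fst_faceNext R (R.faceNext.symm d)).symm.trans (by rw [Equiv.apply_symm_apply])

theorem exists_dart_fst_eq (hF : R.IsFullerene) (v : V) : ∃ d : G.Dart, d.fst = v := by
  obtain ⟨w, hw⟩ : (G.neighborSet v).Nonempty :=
    Set.nonempty_of_ncard_ne_zero (by rw [hF.cubic v]; norm_num)
  exact ⟨⟨(v, w), hw⟩, rfl⟩

/-- An original vertex `v` is the middle of the only path of length two from a neighbour to the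
centre of the face at `v` opposite to this neighbour. -/
theorem inl_not_mem [Finite V] (hF : R.IsFullerene) {X : Set (V ⊕ R.Face)}
    (hX : R.centered.IsTotalMutualVisibilitySet X) (v : V) : Sum.inl v ∉ X := by
  obtain ⟨d, rfl⟩ := hF.exists_dart_fst_eq v
  obtain ⟨p, rfl⟩ := R.faceNext.surjective d
  have hr := hF.faceNext_symm_faceNext (R.faceNext p).symm
  rw [Dart.symm_symm, Equiv.symm_apply_apply] at hr
  have hr' := congrArg R.faceOf hr
  rw [faceOf_faceNext] at hr'
  have hne : ∀ n, 0 < n → n < 5 → ∀ c, R.faceNext^[n] c ≠ c := fun n h h' c =>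
    hF.iterate_faceNext_ne c h h'
  have hv : (R.faceNext p).fst = p.snd := fst_faceNext R p
  refine hX.not_mem (u := .inl (R.faceNext p).snd) (v := .inr (R.faceOf p.symm)) (by simp) ?_
    (R.faceNext p).symm.adj (hv ▸ onFace_fst p.symm) ?_
  · intro h
    replace h : R.OnFace (R.faceNext p).snd (R.faceOf p.symm) := h
    rw [← fst_faceNext, hF.onFace_fst_iff, Equiv.symm_apply_apply] at h
    rcases h with h | h | h
    · exact hF.faceOf_symm_ne p (by simpa using h)
    · exact hne 2 (by norm_num) (by norm_num) p (hF.eq_of_faceOf_symm_eq (by simp) h).symm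
    · exact hne 1 (by norm_num) (by norm_num) p (hF.eq_of_faceOf_symm_eq (by simp) h).symm
  · rintro (x | g) h h'
    swap
    · exact h'.elim
    replace h : G.Adj (R.faceNext p).snd x := h
    replace h' : R.OnFace x (R.faceOf p.symm) := h'
    obtain ⟨t, rfl, ht⟩ : ∃ t : G.Dart, t.snd = x ∧ t.fst = (R.faceNext p).snd :=
      ⟨⟨(_, x), h⟩, rfl, rfl⟩
    rw [← fst_faceNext R] at ht
    rcases hF.eq_or_eq_or_eq_of_fst_eq ht with rfl | rfl | rfl
    · rw [← fst_faceNext, hF.onFace_fst_iff, Equiv.symm_apply_apply] at h'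
      rcases h' with h | h | h
      · exact (hF.faceOf_symm_ne p (by simpa using h)).elim
      · exact (hne 3 (by norm_num) (by norm_num) p (hF.eq_of_faceOf_symm_eq (by simp) h).symm).elim
      · exact (hne 2 (by norm_num) (by norm_num) p (hF.eq_of_faceOf_symm_eq (by simp) h).symm).elim
    · rw [hF.faceNext_symm_faceNext] at h'
      change R.OnFace (R.faceNext.symm (R.faceNext p).symm).fst _ at h'
      rw [hF.onFace_fst_iff, ← hr'] at h'
      generalize (R.faceNext p).symm = q at h'
      rcases h' with h | h | h
      · exact (hF.faceOf_symm_ne (R.faceNext q) (by simpa using h)).elim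
      · refine (hne 2 (by norm_num) (by norm_num) (R.faceNext.symm q) ?_).elim
        simpa using hF.eq_of_faceOf_symm_eq (by simp) h
      · refine (hne 3 (by norm_num) (by norm_num) (R.faceNext.symm (R.faceNext.symm q)) ?_).elim
        simpa using hF.eq_of_faceOf_symm_eq (by simp) h
    · rw [Equiv.symm_apply_apply]
      rfl

/-- The only face containing two vertices at facial distance three is the given one. -/
theorem eq_faceOf_of_onFace_opposite [Finite V] (hF : R.IsFullerene) {c : G.Dart} {g : R.Face}
    (h0 : R.OnFace c.fst g) (h3 : R.OnFace (R.faceNext^[3] c).fst g) : g = R.faceOf c := by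
  obtain ⟨b, rfl⟩ := R.faceNext.surjective c
  have hne : ∀ m n, m < n → n < m + 5 → R.faceOf (R.faceNext^[m] b).symm ≠
      R.faceOf (R.faceNext^[n] b).symm := fun m n h h' he => by
    have h1 := hF.eq_of_faceOf_symm_eq (by simp) he
    obtain ⟨k, rfl⟩ := Nat.exists_eq_add_of_lt h
    rw [show m + k + 1 = m + (k + 1) by omega, Function.iterate_add_apply] at h1
    exact hF.iterate_faceNext_ne b (by omega) (by omega)
      (R.faceNext.injective.iterate m h1).symm
  rw [hF.onFace_fst_iff, Equiv.symm_apply_apply] at h0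
  rw [hF.onFace_fst_iff] at h3
  simp only [Function.iterate_succ_apply, Function.iterate_zero, id, Equiv.symm_apply_apply,
    faceOf_faceNext] at h3 h0 ⊢
  rcases h0 with h0 | h0 | h0
  · exact h0
  · rcases h3 with h3 | h3 | h3
    · exact h3
    · exact (hne 1 4 (by norm_num) (by norm_num) (h0.symm.trans h3)).elim
    · exact (hne 1 3 (by norm_num) (by norm_num) (h0.symm.trans h3)).elim
  · rcases h3 with h3 | h3 | h3
    · exact h3
    · exact (hne 0 4 (by norm_num) (by norm_num) (h0.symm.trans h3)).elim
    · exact (hne 0 3 (by norm_num) (by norm_num) (h0.symm.trans h3)).elim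

/-- The centre of a hexagonal face is the middle of the only path of length two between two opposite
vertices of the hexagon. -/
theorem inr_not_mem [Finite V] (hF : R.IsFullerene) {X : Set (V ⊕ R.Face)}
    (hX : R.centered.IsTotalMutualVisibilitySet X) {f : R.Face} (hf : R.faceLength f = 6) :
    Sum.inr f ∉ X := by
  obtain ⟨c, rfl⟩ := exists_faceOf_eq f
  have hfst : ∀ m n, m < n → n < m + 6 → (R.faceNext^[m] c).fst ≠ (R.faceNext^[n] c).fst := by
    intro m n h h' he
    have h1 := hF.eq_of_fst_eq_of_faceOf_eq he (by simp)
    obtain ⟨k, rfl⟩ := Nat.exists_eq_add_of_lt h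
    rw [show m + k + 1 = m + (k + 1) by omega, Function.iterate_add_apply] at h1
    have h2 := (iterate_faceNext_eq_self_iff _ _).1 (R.faceNext.injective.iterate m h1).symm
    have h3 := Nat.le_of_dvd (by omega) h2
    omega
  refine hX.not_mem (u := .inl c.fst) (v := .inl (R.faceNext^[3] c).fst)
    (fun h => hfst 0 3 (by norm_num) (by norm_num) (Sum.inl.inj h)) ?_ (onFace_fst c)
    ⟨_, faceOf_iterate 3 c, rfl⟩ ?_
  · intro h
    replace h : G.Adj c.fst (R.faceNext^[3] c).fst := h
    obtain ⟨t, ht, ht'⟩ : ∃ t : G.Dart, t.fst = c.fst ∧ t.snd = (R.faceNext^[3] c).fst :=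
      ⟨Dart.mk (c.fst, (R.faceNext^[3] c).fst) h, rfl, rfl⟩
    have h1 := hF.eq_faceOf_of_onFace_opposite (ht ▸ onFace_fst t) (ht' ▸ onFace_snd t)
    have h2 := hF.eq_faceOf_of_onFace_opposite (ht ▸ onFace_fst_symm t) (ht' ▸ onFace_snd_symm t)
    exact hF.faceOf_symm_ne t (h2.trans h1.symm)
  · rintro (x | g) h h'
    swap
    · rw [hF.eq_faceOf_of_onFace_opposite h h']
    exfalso
    replace h : G.Adj c.fst x := h
    replace h' : G.Adj x (R.faceNext^[3] c).fst := h'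
    obtain ⟨t, htx, ht⟩ : ∃ t : G.Dart, t.fst = x ∧ t.snd = c.fst := ⟨⟨(_, _), h.symm⟩, rfl, rfl⟩
    obtain ⟨s, hsx, hs⟩ : ∃ s : G.Dart, s.fst = x ∧ s.snd = (R.faceNext^[3] c).fst :=
      ⟨⟨(_, _), h'⟩, rfl, rfl⟩
    rcases hF.eq_or_eq_or_eq_of_fst_eq (hsx.trans htx.symm) with rfl | rfl | rfl
    · exact hfst 0 3 (by norm_num) (by norm_num) (ht.symm.trans hs)
    · have h1 : R.faceOf t.symm = R.faceOf c := hF.eq_faceOf_of_onFace_opposite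
        (ht ▸ onFace_snd_symm t) (hs ▸ faceOf_faceNext t.symm ▸ onFace_snd (R.faceNext t.symm))
      have h2 : t.symm = c := hF.eq_of_fst_eq_of_faceOf_eq ht h1
      rw [h2, ← fst_faceNext] at hs
      exact hfst 2 3 (by norm_num) (by norm_num) hs
    · obtain ⟨s, rfl⟩ := R.faceNext.surjective t
      rw [Equiv.symm_apply_apply] at hs
      have h1 : R.faceOf s = R.faceOf c := hF.eq_faceOf_of_onFace_opposite
        (ht ▸ faceOf_faceNext s ▸ onFace_snd (R.faceNext s)) (hs ▸ onFace_fst s)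
      have h2 : s = R.faceNext^[3] c := hF.eq_of_fst_eq_of_faceOf_eq hs (by simpa using h1)
      rw [h2, ← fst_faceNext] at ht
      exact hfst 0 5 (by norm_num) (by norm_num) ht.symm

end IsFullerene
end RotationSystem
end SimpleGraph

/-! ### The central vertices of the pentagons -/
namespace SimpleGraph
namespace RotationSystem

variable {V : Type*} {G : SimpleGraph V} {R : G.RotationSystem}

theorem connected_centered (hG : G.Connected) (R : G.RotationSystem) : R.centered.Connected := by
  obtain ⟨v₀⟩ := hG.nonempty
  have hinl : ∀ v, R.centered.Reachable (.inl v₀) (.inl v) := fun v =>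
    (hG.preconnected v₀ v).map (⟨Sum.inl, fun h => h⟩ : G →g R.centered)
  have hall : ∀ x, R.centered.Reachable (.inl v₀) x := by
    rintro (v | f)
    · exact hinl v
    · obtain ⟨d, rfl⟩ := exists_faceOf_eq f
      exact (hinl d.fst).trans (Adj.reachable (onFace_fst d : R.OnFace d.fst _))
  exact (connected_iff _).2 ⟨fun x y => (hall x).symm.trans (hall y), ⟨.inl v₀⟩⟩

/-- Two vertices of a pentagonal face have distance at most two in the original graph. -/
theorem exists_adj_adj_of_pentagon [Finite V] {f : R.Face} (hf : R.faceLength f = 5) {s t : V}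
    (hs : R.OnFace s f) (ht : R.OnFace t f) (hst : s ≠ t) (hadj : ¬ G.Adj s t) :
    ∃ z, G.Adj s z ∧ G.Adj z t := by
  obtain ⟨d, rfl, rfl⟩ := hs
  obtain ⟨e, he, rfl⟩ := ht
  obtain ⟨n, hn, rfl⟩ := exists_iterate_faceNext_eq he.symm
  rw [hf] at hn
  have hstep : ∀ n, G.Adj (R.faceNext^[n] d).fst (R.faceNext^[n + 1] d).fst := fun n => by
    rw [Function.iterate_succ_apply', fst_faceNext]
    exact (R.faceNext^[n] d).adj
  have h5 : R.faceNext^[5] d = d := (iterate_faceNext_eq_self_iff d 5).2 (by rw [hf])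
  have h4 := hstep 4
  rw [h5] at h4
  interval_cases n
  · exact (hst rfl).elim
  · exact (hadj (hstep 0)).elim
  · exact ⟨_, hstep 0, hstep 1⟩
  · exact ⟨_, h4.symm, (hstep 3).symm⟩
  · exact (hadj h4.symm).elim

/-- On a shortest path, the central vertex of a pentagon can be replaced by a vertex of the
pentagon, unless it is an end-vertex. -/
theorem isTotalMutualVisibilitySet_pentagonCenters [Finite V] (hG : G.Connected)
    (R : G.RotationSystem) : R.centered.IsTotalMutualVisibilitySet R.pentagonCenters := by
  have hc := connected_centered hG R
  have key : ∀ {u v} (p : R.centered.Walk u v), p.length = R.centered.dist u v →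
      ∃ q : R.centered.Walk u v, q.length = R.centered.dist u v ∧
        ∀ w ∈ q.support, w ∈ R.pentagonCenters → w = u ∨ w = v := by
    intro u v p
    induction p with
    | nil => exact fun _ => ⟨.nil, by simp, by simp⟩
    | @cons u x v h p ih =>
      intro hp
      rw [Walk.length_cons] at hp
      have hx : p.length = R.centered.dist x v := by
        have h1 := dist_le p
        have h2 := hc.dist_triangle (u := u) (v := x) (w := v)
        rw [dist_eq_one_iff_adj.2 h] at h2
        omega
      obtain ⟨q, hq, hqX⟩ := ih hx
      by_cases hxX : x ∈ R.pentagonCenters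
      swap
      · refine ⟨.cons h q, by rw [Walk.length_cons]; omega, fun w hw hwX => ?_⟩
        rw [Walk.support_cons, List.mem_cons] at hw
        rcases hw with hw | hw
        · exact .inl hw
        · refine .inr ((hqX w hw hwX).resolve_left fun h' => hxX (h' ▸ hwX))
      have hqp := q.isPath_of_length_eq_dist hq
      cases q with
      | nil => exact ⟨.cons h .nil, (dist_eq_one_iff_adj.2 h).symm, by simp⟩
      | @cons _ y _ h' q =>
        rw [Walk.length_cons] at hq
        have hle : ∀ r : R.centered.Walk u y, 2 ≤ r.length := fun r => by
          have := dist_le (r.append q)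
          rw [Walk.length_append] at this
          omega
        -- The neighbours `u` and `y` of the centre `x` are original vertices of its pentagon.
        obtain ⟨f, hf, rfl⟩ := hxX
        rcases u with s | g
        swap
        · exact h.elim
        rcases y with t | g
        swap
        · exact h'.elim
        obtain ⟨z, hz, hz'⟩ := exists_adj_adj_of_pentagon (R := R) hf h h'
          (by rintro rfl; simpa using hle .nil)
          (fun hst => by simpa using hle (.cons (show R.centered.Adj (.inl s) (.inl t) from hst) .nil))
        refine ⟨.cons (show R.centered.Adj (.inl s) (.inl z) from hz)
          (.cons (show R.centered.Adj (.inl z) (.inl t) from hz') q), ?_, fun w hw hwX => ?_⟩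
        · rw [Walk.length_cons, Walk.length_cons]; omega
        · rw [Walk.support_cons, Walk.support_cons, List.mem_cons, List.mem_cons] at hw
          rcases hw with hw | hw | hw
          · exact .inl hw
          · -- The new vertex `z` is an original vertex, hence not a centre.
            obtain ⟨g, -, rfl⟩ := hwX
            cases hw
          · -- The replaced centre does not come back, since `q` was a path.
            refine .inr ((hqX w (by simp [hw]) hwX).resolve_left fun h' => ?_)
            subst h'
            exact ((Walk.cons_isPath_iff _ _).1 hqp).2 hw
  intro u v
  obtain ⟨p, hp⟩ := hc.exists_walk_length_eq_dist u v
  obtain ⟨q, hq, hqX⟩ := key p hp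
  exact ⟨q, q.isPath_of_length_eq_dist hq, hq, hqX⟩

namespace IsFullerene

/-- A total mutual-visibility set contains neither original vertices nor centres of hexagons. -/
theorem subset_pentagonCenters [Finite V] (hF : R.IsFullerene) {X : Set (V ⊕ R.Face)}
    (hX : R.centered.IsTotalMutualVisibilitySet X) : X ⊆ R.pentagonCenters := by
  rintro (v | f) h
  · exact (hF.inl_not_mem hX v h).elim
  · exact ⟨f, (hF.pentagon_or_hexagon f).resolve_right fun h6 => hF.inr_not_mem hX h6 h, rfl⟩

theorem ncard_pentagonCenters [Finite V] (hF : R.IsFullerene) : R.pentagonCenters.ncard = 12 := by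
  rw [pentagonCenters, Set.ncard_image_of_injective _ Sum.inr_injective, hF.ncard_pentagons]

end IsFullerene
end RotationSystem
end SimpleGraph

theorem proposition4p3 {V : Type*} [Finite V] (F : SimpleGraph V) (R : F.RotationSystem)
    (hF : R.IsFullerene) :
    R.centered.totalMutualVisibilityNumber = 12 ∧
      R.pentagonCenters.ncard = 12 ∧
      R.centered.IsTotalMutualVisibilitySet R.pentagonCenters := by
  have hX := SimpleGraph.RotationSystem.isTotalMutualVisibilitySet_pentagonCenters
    hF.plane.connected R
  refine ⟨IsGreatest.csSup_eq ⟨?_, ?_⟩, hF.ncard_pentagonCenters, hX⟩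
  · have hfin : R.pentagonCenters.Finite := Set.toFinite _
    refine ⟨hfin.toFinset, by rwa [hfin.coe_toFinset], ?_⟩
    rw [← Set.ncard_eq_toFinset_card _ hfin, hF.ncard_pentagonCenters]
  · rintro n ⟨X, hX, rfl⟩
    rw [← hF.ncard_pentagonCenters, ← Set.ncard_coe_finset]
    exact Set.ncard_le_ncard (hF.subset_pentagonCenters hX)
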